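/- Let $d\ge 0$ and $\ell\ge 1$ be integers and let $k_1,\dots,k_\ell\ge 1$ be integers with $n=k_1+\cdots+k_\ell$. All vector spaces and tensor products are over $\mathbb{C}$. Let $\mathcal{G}_{(\ell,d)}$ be the groupoid whose objects are the maps $f:\{1,\dots,d\}\to\{1,\dots,\ell\}$, whose morphisms $f\to g$ are the bijections $\sigma$ of $\{1,\dots,d\}$ with $g\circ\sigma=f$, and whose composition is composition of maps. Let $A_{(\ell,d)}=\bigoplus_{f,g}\mathbb{C}[\mathcal{G}_{(\ell,d)}(f,g)]$ be its algebra, with the product given by composition (and zero for non-composable morphisms). Write $\sigma_{(f,g)}\in A_{(\ell,d)}$ for the basis element given by $\sigma\in\mathcal{G}_{(\ell,d)}(f,g)$, and $e_f$ for the one given by the identity of $f$. Let $\mathbf{C}_\ell$ be the group of complex $\ell$-th roots of unity and $S(\ell,d)=\mathbf{C}_\ell\wr S_d=\mathbf{C}_\ell^d\rtimes S_d$. Then for every primitive $\ell$-th root of unity $\xi$ there is an isomorphism of $\mathbb{C}$-algebras $\Phi:\mathbb{C}[S(\ell,d)]\to A_{(\ell,d)}$ with $\Phi(\sigma)=\sum_{f}\sigma_{(f,\,f\circ\sigma^{-1})}$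 for all $\sigma\in S_d$, and $\Phi(s_0^{(j)})=\sum_f\xi^{f(j)}e_f$ for $1\le j\le d$, where $s_0^{(j)}\in\mathbf{C}_\ell^d$ has $j$-th entry $\xi$ and all other entries $1$. Let $V=\mathbb{C}^n=V_1\oplus\cdots\oplus V_\ell$, where $V_i$ is spanned by the standard basis vectors $v_j$ with $k_1+\cdots+k_{i-1}<j\le k_1+\cdots+k_i$, and let $\mathbf{GL}_{\mathbf{k}}\cong\mathbf{GL}_{k_1}(\mathbb{C})\times\cdots\times\mathbf{GL}_{k_\ell}(\mathbb{C})$ be the corresponding block-diagonal subgroup of $\mathbf{GL}_n(\mathbb{C})$. It acts diagonally on $V^{\otimes d}$. The algebra $A_{(\ell,d)}$ acts on $V^{\otimes d}=\bigoplus_f V_{f(1)}\otimes\cdots\otimes V_{f(d)}$ as follows: $\sigma_{(f,g)}$ sends $w_1\otimes\cdots\otimes w_d$ with $w_i\in V_{f(i)}$ for all $i$ to $w_{\sigma^{-1}(1)}\otimes\cdots\otimes w_{\sigma^{-1}(d)}$, and is zero on the summands indexed by $f'\ne f$. Then the two actions on $V^{\otimes d}$ generate each other's centralizers: the algebra of all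 linear operators on $V^{\otimes d}$ that commute with the action of $\mathbf{GL}_{\mathbf{k}}$ is generated by the action of $A_{(\ell,d)}$, and the algebra of all linear operators that commute with the action of $A_{(\ell,d)}$ is generated by the action of $\mathbf{GL}_{\mathbf{k}}$. -/

import Mathlib

open scoped TensorProduct

noncomputable section

namespace SchurWeyl

open CategoryTheory

/-! ### The groupoid of colored permutations and its algebra -/

/-- Objects of the groupoid: colorings of `d` dots by `ℓ` colors. -/
@[ext]
structure Coloring (ℓ d : ℕ) where
  /-- the color of each dot -/
  color : Fin d → Fin ℓ

/-- Colorings are the same thing as maps `Fin d → Fin ℓ`. -/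
def Coloring.equivFun (ℓ d : ℕ) : Coloring ℓ d ≃ (Fin d → Fin ℓ) where
  toFun f := f.color
  invFun f := ⟨f⟩
  left_inv _ := rfl
  right_inv _ := rfl

instance (ℓ d : ℕ) : Fintype (Coloring ℓ d) := Fintype.ofEquiv _ (Coloring.equivFun ℓ d).symm

instance (ℓ d : ℕ) : DecidableEq (Coloring ℓ d) := (Coloring.equivFun ℓ d).decidableEq

/-- Morphisms `f ⟶ g` are the color preserving bijections `σ`, that is `g ∘ σ = f`; the
composition `σ ≫ τ` is the composition of maps `τ ∘ σ`. -/
instance coloringGroupoid (ℓ d : ℕ) : Groupoid (Coloring ℓ d) where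
  Hom f g := {σ : Equiv.Perm (Fin d) // g.color ∘ σ = f.color}
  id f := ⟨1, rfl⟩
  comp {f g h} σ τ := ⟨τ.1 * σ.1, by
    funext i; exact (congrFun τ.2 (σ.1 i)).trans (congrFun σ.2 i)⟩
  inv {f g} σ := ⟨σ.1⁻¹, by
    funext i; simpa using (congrFun σ.2 (σ.1⁻¹ i)).symm⟩
  inv_comp {f g} σ := Subtype.ext (by simp)
  comp_inv {f g} σ := Subtype.ext (by simp)

/-- The algebra of a category `C` with finitely many objects: the direct sum of the spaces
`ℂ[C(f, g)]` with basis the morphisms `f ⟶ g`. -/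
@[ext]
structure CatAlg (C : Type*) [Category C] where
  /-- the components -/
  coeff : ∀ f g : C, (f ⟶ g) →₀ ℂ

namespace CatAlg

section

variable {C : Type*} [Category C]

/-- The vector space structure is that of the direct sum of the spaces `ℂ[C(f, g)]`. -/
def equivPi (C : Type*) [Category C] : CatAlg C ≃ (∀ f g : C, (f ⟶ g) →₀ ℂ) where
  toFun a := a.coeff
  invFun a := ⟨a⟩
  left_inv _ := rfl
  right_inv _ := rfl

instance : AddCommGroup (CatAlg C) := (equivPi C).addCommGroup

instance : Module ℂ (CatAlg C) := (equivPi C).module ℂ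

@[simp] theorem coeff_zero (f g : C) : (0 : CatAlg C).coeff f g = 0 := rfl

@[simp] theorem coeff_add (a b : CatAlg C) (f g : C) :
    (a + b).coeff f g = a.coeff f g + b.coeff f g := rfl

@[simp] theorem coeff_smul (c : ℂ) (a : CatAlg C) (f g : C) :
    (c • a).coeff f g = c • a.coeff f g := rfl

/-- The bilinear extension `ℂ[C(f, g)] × ℂ[C(g, h)] → ℂ[C(f, h)]` of the composition. -/
def compL (f g h : C) : ((f ⟶ g) →₀ ℂ) →ₗ[ℂ] ((g ⟶ h) →₀ ℂ) →ₗ[ℂ] ((f ⟶ h) →₀ ℂ) :=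
  Finsupp.linearCombination ℂ fun σ : f ⟶ g =>
    Finsupp.linearCombination ℂ fun τ : g ⟶ h => Finsupp.single (σ ≫ τ) (1 : ℂ)

@[simp] theorem compL_single {f g h : C} (σ : f ⟶ g) (τ : g ⟶ h) (r s : ℂ) :
    compL f g h (Finsupp.single σ r) (Finsupp.single τ s) = Finsupp.single (σ ≫ τ) (r * s) := by
  simp [compL]

theorem compL_assoc {f g h i : C} (a : (f ⟶ g) →₀ ℂ) (b : (g ⟶ h) →₀ ℂ) (c : (h ⟶ i) →₀ ℂ) :
    compL f h i (compL f g h a b) c = compL f g i a (compL g h i b c) := by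
  induction a using Finsupp.induction_linear with
  | zero => simp
  | add a a' ha ha' => simp [ha, ha']
  | single σ r =>
    induction b using Finsupp.induction_linear with
    | zero => simp
    | add b b' hb hb' => simp [hb, hb']
    | single τ s =>
      induction c using Finsupp.induction_linear with
      | zero => simp
      | add c c' hc hc' => simp only [map_add, hc, hc']
      | single ρ t => simp only [compL_single, Category.assoc, mul_assoc]

@[simp] theorem compL_id_left {f g : C} (a : (f ⟶ g) →₀ ℂ) :
    compL f f g (Finsupp.single (𝟙 f) 1) a = a := by
  induction a using Finsupp.induction_linear with
  | zero => simp
  | add a b ha hb => simp [ha, hb]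
  | single σ r => simp

@[simp] theorem compL_id_right {f g : C} (a : (f ⟶ g) →₀ ℂ) :
    compL f g g a (Finsupp.single (𝟙 g) 1) = a := by
  induction a using Finsupp.induction_linear with
  | zero => simp
  | add a b ha hb => simp [ha, hb]
  | single σ r => simp

/-- The product `a * b` is "`a` after `b`". -/
instance [Fintype C] : Mul (CatAlg C) where
  mul a b := ⟨fun f h => ∑ g : C, compL f g h (b.coeff f g) (a.coeff g h)⟩

/-- The unit is the sum of all identity morphisms. -/
instance [DecidableEq C] : One (CatAlg C) where
  one := ⟨fun f g => if h : f = g then Finsupp.single (eqToHom h) 1 else 0⟩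

theorem coeff_mul [Fintype C] (a b : CatAlg C) (f h : C) :
    (a * b).coeff f h = ∑ g : C, compL f g h (b.coeff f g) (a.coeff g h) := rfl

theorem coeff_one [DecidableEq C] (f g : C) :
    (1 : CatAlg C).coeff f g = if h : f = g then Finsupp.single (eqToHom h) 1 else 0 := rfl

end

variable {C : Type*} [Category C] [Fintype C] [DecidableEq C]

instance : Ring (CatAlg C) where
  __ := (inferInstance : AddCommGroup (CatAlg C))
  left_distrib a b c := by
    refine CatAlg.ext (funext₂ fun f h => ?_); simp [coeff_mul, Finset.sum_add_distrib]
  right_distrib a b c := by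
    refine CatAlg.ext (funext₂ fun f h => ?_); simp [coeff_mul, Finset.sum_add_distrib]
  zero_mul a := by refine CatAlg.ext (funext₂ fun f h => ?_); simp [coeff_mul]
  mul_zero a := by refine CatAlg.ext (funext₂ fun f h => ?_); simp [coeff_mul]
  mul_assoc a b c := by
    refine CatAlg.ext (funext₂ fun f h => ?_)
    simp only [coeff_mul, map_sum, LinearMap.sum_apply, compL_assoc]
    exact Finset.sum_comm
  one_mul a := by
    refine CatAlg.ext (funext₂ fun f h => ?_)
    rw [coeff_mul, Finset.sum_eq_single h]
    · simp [coeff_one]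
    · intro g _ hg; simp [coeff_one, hg]
    · simp
  mul_one a := by
    refine CatAlg.ext (funext₂ fun f h => ?_)
    rw [coeff_mul, Finset.sum_eq_single f]
    · simp [coeff_one]
    · intro g _ hg; simp [coeff_one, Ne.symm hg]
    · simp

instance : Algebra ℂ (CatAlg C) :=
  Algebra.ofModule
    (by intro r a b; refine CatAlg.ext (funext₂ fun f h => ?_); simp [coeff_mul, Finset.smul_sum])
    (by intro r a b; refine CatAlg.ext (funext₂ fun f h => ?_); simp [coeff_mul, Finset.smul_sum])

/-- The basis element given by a morphism `σ : f ⟶ g`. -/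
def morph {f g : C} (σ : f ⟶ g) : CatAlg C :=
  ⟨Pi.single (M := fun f' => ∀ g', (f' ⟶ g') →₀ ℂ) f
    (Pi.single (M := fun g' => (f ⟶ g') →₀ ℂ) g (Finsupp.single σ 1))⟩

end CatAlg

/-- The groupoid algebra `A_(ℓ,d)`. -/
abbrev GroupoidAlg (ℓ d : ℕ) := CatAlg (Coloring ℓ d)

/-! ### The wreath product -/

/-- The generalized symmetric group `S(ℓ,d) = C_ℓ ≀ S_d`, where `C_ℓ` is the group of complex
`ℓ`-th roots of unity and `S_d` permutes the coordinates of `C_ℓ ^ d`. -/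
abbrev GenSym (ℓ d : ℕ) :=
  (Fin d → rootsOfUnity ℓ ℂ) ⋊[mulAutArrow (G := Equiv.Perm (Fin d))] Equiv.Perm (Fin d)

/-- A permutation `σ`, as an element of `ℂ[S(ℓ,d)]`. -/
def permElt (ℓ : ℕ) {d : ℕ} (σ : Equiv.Perm (Fin d)) : MonoidAlgebra ℂ (GenSym ℓ d) :=
  MonoidAlgebra.of ℂ (GenSym ℓ d) (SemidirectProduct.inr σ)

/-- The element of `ℂ[S(ℓ,d)]` with the root of unity `ξ` at place `j` and `1` elsewhere (a
diagonal monomial matrix). -/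
def diagElt {ℓ d : ℕ} (ξ : rootsOfUnity ℓ ℂ) (j : Fin d) : MonoidAlgebra ℂ (GenSym ℓ d) :=
  MonoidAlgebra.of ℂ (GenSym ℓ d) (SemidirectProduct.inl (Pi.mulSingle j ξ))

/-- The coloring `f ∘ σ⁻¹`, the only `g` such that `σ` is a morphism `f ⟶ g`. -/
def Coloring.push {ℓ d : ℕ} (σ : Equiv.Perm (Fin d)) (f : Coloring ℓ d) : Coloring ℓ d :=
  ⟨f.color ∘ σ.symm⟩

/-- The permutation `σ` as a morphism from `f` to `f ∘ σ⁻¹`. -/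
def Coloring.pushHom {ℓ d : ℕ} (σ : Equiv.Perm (Fin d)) (f : Coloring ℓ d) :
    f ⟶ f.push σ :=
  ⟨σ, by funext i; simp [Coloring.push]⟩

/-! ### The block-diagonal group and the tensor space -/

/-- The natural representation `V = ℂ ^ n`, where `n = k₁ + ⋯ + k_ℓ`. -/
abbrev NatRep {ℓ : ℕ} (k : Fin ℓ → ℕ) := Fin (∑ i, k i) → ℂ

/-- The block containing the index `j`, where `{1, …, n}` is cut into consecutive intervals of
lengths `k₁, …, k_ℓ`. -/
def block {ℓ : ℕ} (k : Fin ℓ → ℕ) (j : Fin (∑ i, k i)) : Fin ℓ := (finSigmaFinEquiv.symm j).1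

/-- The embedding `(x₁, …, x_ℓ) ↦ diag(x₁, …, x_ℓ)` of `GL_{k₁} × ⋯ × GL_{k_ℓ}` in `GL_n`. -/
def diagGL {ℓ : ℕ} (k : Fin ℓ → ℕ) :
    (∀ i, GL (Fin (k i)) ℂ) →* GL (Fin (∑ i, k i)) ℂ :=
  (Units.map
    (((Matrix.reindexAlgEquiv ℂ ℂ (finSigmaFinEquiv (n := k))).toRingEquiv.toRingHom.comp
      (Matrix.blockDiagonal'RingHom (fun i => Fin (k i)) ℂ)).toMonoidHom)).comp
    (MulEquiv.piUnits (M := fun i => Matrix (Fin (k i)) (Fin (k i)) ℂ)).symm.toMonoidHom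

/-- The block-diagonal subgroup `GL_k` of `GL_n`. -/
def BlockGL {ℓ : ℕ} (k : Fin ℓ → ℕ) : Subgroup (GL (Fin (∑ i, k i)) ℂ) := (diagGL k).range

/-- The tensor power `V ^ ⊗ d`. -/
abbrev TensorSpace {ℓ : ℕ} (k : Fin ℓ → ℕ) (d : ℕ) := ⨂[ℂ] _ : Fin d, NatRep k

/-- The diagonal action of `GL_k` on `V ^ ⊗ d`. -/
def glAction {ℓ : ℕ} (k : Fin ℓ → ℕ) (d : ℕ) :
    Representation ℂ (BlockGL k) (TensorSpace k d) where
  toFun x := PiTensorProduct.map fun _ => Matrix.mulVecLin (x : GL (Fin (∑ i, k i)) ℂ).1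
  map_one' := by
    simp [← Module.End.one_eq_id]
  map_mul' x y := by
    simp only [Subgroup.coe_mul, Units.val_mul, Matrix.mulVecLin_mul]
    exact PiTensorProduct.map_comp ..

/-- The summand `V_i` of `V`, spanned by the standard basis vectors of the `i`-th block. -/
def summand {ℓ : ℕ} (k : Fin ℓ → ℕ) (i : Fin ℓ) : Submodule ℂ (NatRep k) :=
  Submodule.span ℂ {v | ∃ j, block k j = i ∧ v = Pi.single j 1}

/-- The projection of `V = V₁ ⊕ ⋯ ⊕ V_ℓ` onto `V_i`. -/
def proj {ℓ : ℕ} (k : Fin ℓ → ℕ) (i : Fin ℓ) : NatRep k →ₗ[ℂ] NatRep k :=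
  LinearMap.pi fun j => if block k j = i then LinearMap.proj j else 0

/-- The projection of `V ^ ⊗ d`, which is the direct sum of all
`G(f) = V_{f(1)} ⊗ ⋯ ⊗ V_{f(d)}`, onto `G(f)`. -/
def tensorProj {ℓ d : ℕ} (k : Fin ℓ → ℕ) (f : Coloring ℓ d) :
    TensorSpace k d →ₗ[ℂ] TensorSpace k d :=
  PiTensorProduct.map fun m => proj k (f.color m)

/-- The permutation of the tensor factors:
`w₁ ⊗ ⋯ ⊗ w_d ↦ w_{σ⁻¹(1)} ⊗ ⋯ ⊗ w_{σ⁻¹(d)}`. -/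
def permuteFactors {ℓ d : ℕ} (k : Fin ℓ → ℕ) (σ : Equiv.Perm (Fin d)) :
    TensorSpace k d →ₗ[ℂ] TensorSpace k d :=
  (PiTensorProduct.reindex ℂ (fun _ => NatRep k) σ).toLinearMap

/-- The action of a morphism `σ : f ⟶ g` on `V ^ ⊗ d`: it permutes the factors of tensors in
`G(f)`, and kills `G(f')` for `f' ≠ f`. -/
def morphAction {ℓ d : ℕ} (k : Fin ℓ → ℕ) {f g : Coloring ℓ d} (σ : f ⟶ g) :
    Module.End ℂ (TensorSpace k d) :=
  permuteFactors k σ.1 ∘ₗ tensorProj k f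

theorem proj_apply {ℓ : ℕ} (k : Fin ℓ → ℕ) (i : Fin ℓ) (v : NatRep k) (j : Fin (∑ i, k i)) :
    proj k i v j = if block k j = i then v j else 0 := by
  unfold proj
  split_ifs with h <;> simp [h]

theorem proj_comp_proj {ℓ : ℕ} (k : Fin ℓ → ℕ) (i i' : Fin ℓ) :
    proj k i ∘ₗ proj k i' = if i = i' then proj k i else 0 := by
  ext v j
  split_ifs with h
  · subst h
    simp only [LinearMap.comp_apply, proj_apply]
    split_ifs <;> rfl
  · simp only [LinearMap.comp_apply, proj_apply, LinearMap.zero_apply, Pi.zero_apply]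
    grind

theorem sum_proj {ℓ : ℕ} (k : Fin ℓ → ℕ) : ∑ i, proj k i = LinearMap.id := by
  refine LinearMap.ext fun v => funext fun j => ?_
  simp [LinearMap.sum_apply, Finset.sum_apply, proj_apply]

theorem tensorProj_comp {ℓ d : ℕ} (k : Fin ℓ → ℕ) (f g : Coloring ℓ d) :
    tensorProj k f ∘ₗ tensorProj k g = if f = g then tensorProj k f else 0 := by
  unfold tensorProj
  rw [← PiTensorProduct.map_comp]
  simp only [proj_comp_proj]
  split_ifs with h
  · simp [h]
  · obtain ⟨m, hm⟩ : ∃ m, f.color m ≠ g.color m := by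
      by_contra! hc
      exact h (Coloring.ext (funext hc))
    refine PiTensorProduct.ext (MultilinearMap.ext fun v => ?_)
    simp only [LinearMap.compMultilinearMap_apply, PiTensorProduct.map_tprod]
    exact (PiTensorProduct.tprod ℂ).map_coord_zero m (by simp [hm])

theorem sum_tensorProj {ℓ : ℕ} (k : Fin ℓ → ℕ) (d : ℕ) :
    ∑ f : Coloring ℓ d, tensorProj k f = LinearMap.id := by
  refine PiTensorProduct.ext (MultilinearMap.ext fun v => ?_)
  have h : v = fun m => ∑ i, proj k i (v m) := by
    funext m
    rw [← LinearMap.sum_apply, sum_proj]; rfl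
  conv_rhs => rw [h]
  simp only [LinearMap.compMultilinearMap_apply, LinearMap.sum_apply, LinearMap.id_apply]
  rw [MultilinearMap.map_sum]
  refine Fintype.sum_equiv (Coloring.equivFun ℓ d) _ _ fun f => ?_
  simp [tensorProj, Coloring.equivFun]

theorem permuteFactors_tprod {ℓ d : ℕ} (k : Fin ℓ → ℕ) (σ : Equiv.Perm (Fin d))
    (w : Fin d → NatRep k) :
    permuteFactors k σ (PiTensorProduct.tprod ℂ w) =
      PiTensorProduct.tprod ℂ fun m => w (σ.symm m) :=
  PiTensorProduct.reindex_tprod σ w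

theorem tensorProj_tprod {ℓ d : ℕ} (k : Fin ℓ → ℕ) (f : Coloring ℓ d) (w : Fin d → NatRep k) :
    tensorProj k f (PiTensorProduct.tprod ℂ w) =
      PiTensorProduct.tprod ℂ fun m => proj k (f.color m) (w m) :=
  PiTensorProduct.map_tprod _ _

theorem tensorProj_comp_permute {ℓ d : ℕ} (k : Fin ℓ → ℕ) {f g : Coloring ℓ d} (σ : f ⟶ g) :
    tensorProj k g ∘ₗ permuteFactors k σ.1 = permuteFactors k σ.1 ∘ₗ tensorProj k f := by
  refine PiTensorProduct.ext (MultilinearMap.ext fun v => ?_)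
  simp only [LinearMap.compMultilinearMap_apply, LinearMap.comp_apply, tensorProj_tprod,
    permuteFactors_tprod]
  congr 1
  funext m
  have := congrFun σ.2 (σ.1.symm m)
  simp only [Function.comp_apply, Equiv.apply_symm_apply] at this
  rw [this]

theorem permute_comp {ℓ d : ℕ} (k : Fin ℓ → ℕ) (σ τ : Equiv.Perm (Fin d)) :
    permuteFactors k τ ∘ₗ permuteFactors k σ = permuteFactors k (τ * σ) := by
  refine PiTensorProduct.ext (MultilinearMap.ext fun v => ?_)
  simp only [LinearMap.compMultilinearMap_apply, LinearMap.comp_apply, permuteFactors_tprod]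
  rfl

theorem morphAction_comp {ℓ d : ℕ} (k : Fin ℓ → ℕ) {f g h : Coloring ℓ d}
    (σ : f ⟶ g) (τ : g ⟶ h) :
    morphAction k τ * morphAction k σ = morphAction k (σ ≫ τ) := by
  change (permuteFactors k τ.1 ∘ₗ tensorProj k g) ∘ₗ (permuteFactors k σ.1 ∘ₗ tensorProj k f) =
    permuteFactors k (τ.1 * σ.1) ∘ₗ tensorProj k f
  rw [LinearMap.comp_assoc, ← LinearMap.comp_assoc _ _ (tensorProj k g),
    tensorProj_comp_permute, LinearMap.comp_assoc, tensorProj_comp, if_pos rfl,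
    ← LinearMap.comp_assoc, permute_comp]

theorem morphAction_comp_ne {ℓ d : ℕ} (k : Fin ℓ → ℕ) {f g g' h : Coloring ℓ d}
    (σ : f ⟶ g) (τ : g' ⟶ h) (hne : g' ≠ g) :
    morphAction k τ * morphAction k σ = 0 := by
  change (permuteFactors k τ.1 ∘ₗ tensorProj k g') ∘ₗ (permuteFactors k σ.1 ∘ₗ tensorProj k f) = 0
  rw [← tensorProj_comp_permute k σ, LinearMap.comp_assoc,
    ← LinearMap.comp_assoc _ _ (tensorProj k g'), tensorProj_comp, if_neg hne]
  simp

theorem morphAction_id {ℓ d : ℕ} (k : Fin ℓ → ℕ) (f : Coloring ℓ d) :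
    morphAction k (𝟙 f) = tensorProj k f := by
  change permuteFactors k 1 ∘ₗ tensorProj k f = _
  have : permuteFactors k (1 : Equiv.Perm (Fin d)) = LinearMap.id := by
    refine PiTensorProduct.ext (MultilinearMap.ext fun v => ?_)
    simp only [LinearMap.compMultilinearMap_apply, permuteFactors_tprod]
    rfl
  rw [this, LinearMap.id_comp]

/-- The linear extension of the action of morphisms to `ℂ[G(f, g)]`. -/
def homAction {ℓ d : ℕ} (k : Fin ℓ → ℕ) (f g : Coloring ℓ d) :
    ((f ⟶ g) →₀ ℂ) →ₗ[ℂ] Module.End ℂ (TensorSpace k d) :=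
  Finsupp.linearCombination ℂ fun σ : f ⟶ g => morphAction k σ

@[simp] theorem homAction_single {ℓ d : ℕ} (k : Fin ℓ → ℕ) {f g : Coloring ℓ d} (σ : f ⟶ g)
    (r : ℂ) : homAction k f g (Finsupp.single σ r) = r • morphAction k σ := by
  simp [homAction]

theorem homAction_comp {ℓ d : ℕ} (k : Fin ℓ → ℕ) {f g h : Coloring ℓ d}
    (a : (f ⟶ g) →₀ ℂ) (b : (g ⟶ h) →₀ ℂ) :
    homAction k f h (CatAlg.compL f g h a b) = homAction k g h b * homAction k f g a := by
  induction a using Finsupp.induction_linear with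
  | zero => simp
  | add a a' ha ha' => simp [ha, ha', mul_add]
  | single σ r =>
    induction b using Finsupp.induction_linear with
    | zero => simp
    | add b b' hb hb' => simp [hb, hb', add_mul]
    | single τ s =>
      simp only [CatAlg.compL_single, homAction_single, smul_mul_smul_comm, morphAction_comp,
        mul_comm]

theorem homAction_comp_ne {ℓ d : ℕ} (k : Fin ℓ → ℕ) {f g g' h : Coloring ℓ d}
    (a : (f ⟶ g) →₀ ℂ) (b : (g' ⟶ h) →₀ ℂ) (hne : g' ≠ g) :
    homAction k g' h b * homAction k f g a = 0 := by
  induction a using Finsupp.induction_linear with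
  | zero => simp
  | add a a' ha ha' => simp [ha, ha', mul_add]
  | single σ r =>
    induction b using Finsupp.induction_linear with
    | zero => simp
    | add b b' hb hb' => rw [map_add, add_mul, hb, hb', add_zero]
    | single τ s =>
      simp only [homAction_single, smul_mul_smul_comm, morphAction_comp_ne k _ _ hne, smul_zero]

/-- The action of `A_(ℓ,d)` on `V ^ ⊗ d`. -/
def groupoidAction {ℓ : ℕ} (k : Fin ℓ → ℕ) (d : ℕ) :
    GroupoidAlg ℓ d →ₐ[ℂ] Module.End ℂ (TensorSpace k d) :=
  AlgHom.ofLinearMap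
    { toFun := fun a => ∑ f, ∑ g, homAction k f g (a.coeff f g)
      map_add' := fun a b => by simp [Finset.sum_add_distrib]
      map_smul' := fun c a => by simp [Finset.smul_sum] }
    (by
      change ∑ f, ∑ g, homAction k f g ((1 : GroupoidAlg ℓ d).coeff f g) = LinearMap.id
      rw [← sum_tensorProj k d]
      refine Finset.sum_congr rfl fun f _ => ?_
      rw [Finset.sum_eq_single f]
      · rw [CatAlg.coeff_one, dif_pos rfl, eqToHom_refl, homAction_single, one_smul,
          morphAction_id]
      · intro g _ hg
        rw [CatAlg.coeff_one, dif_neg (Ne.symm hg), map_zero]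
      · simp)
    (by
      intro a b
      change ∑ f, ∑ h, homAction k f h ((a * b).coeff f h) =
        (∑ f, ∑ g, homAction k f g (a.coeff f g)) * ∑ f, ∑ g, homAction k f g (b.coeff f g)
      have h1 : ∀ f g : Coloring ℓ d,
          (∑ g', ∑ h, homAction k g' h (a.coeff g' h)) * homAction k f g (b.coeff f g) =
            ∑ h, homAction k f h (CatAlg.compL f g h (b.coeff f g) (a.coeff g h)) := by
        intro f g
        simp only [Finset.sum_mul]
        rw [Finset.sum_eq_single g]
        · simp only [homAction_comp]
        · intro g' _ hg'
          exact Finset.sum_eq_zero fun h _ => homAction_comp_ne k _ _ hg'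
        · simp
      simp only [Finset.mul_sum, h1, CatAlg.coeff_mul, map_sum]
      exact Finset.sum_congr rfl fun f _ => Finset.sum_comm)

theorem groupoidAction_morph {ℓ d : ℕ} (k : Fin ℓ → ℕ) {f g : Coloring ℓ d} (σ : f ⟶ g) :
    groupoidAction k d (CatAlg.morph σ) = morphAction k σ := by
  change ∑ f' : Coloring ℓ d, ∑ g' : Coloring ℓ d,
    homAction k f' g' ((CatAlg.morph σ).coeff f' g') = _
  rw [Finset.sum_eq_single f, Finset.sum_eq_single g]
  · simp [CatAlg.morph]
  · intro g' _ hg'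
    simp [CatAlg.morph, hg']
  · simp
  · intro f' _ hf'
    refine Finset.sum_eq_zero fun g' _ => ?_
    simp [CatAlg.morph, hf']
  · simp

/-- `V_i` is the image of the projection onto it. -/
theorem mem_summand_iff {ℓ : ℕ} (k : Fin ℓ → ℕ) (i : Fin ℓ) (v : NatRep k) :
    v ∈ summand k i ↔ proj k i v = v := by
  constructor
  · intro hv
    have hle : summand k i ≤ LinearMap.eqLocus (proj k i) LinearMap.id := by
      refine Submodule.span_le.2 ?_
      rintro _ ⟨j, hj, rfl⟩
      refine funext fun j' => ?_
      simp only [proj_apply, LinearMap.id_apply, Pi.single_apply]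
      grind
    exact hle hv
  · intro hv
    rw [← hv, pi_eq_sum_univ' (proj k i v)]
    refine Submodule.sum_mem _ fun j _ => ?_
    by_cases hj : block k j = i
    · refine Submodule.smul_mem _ _ (Submodule.subset_span ⟨j, hj, ?_⟩)
      funext j'
      simp [Pi.single_apply, eq_comm]
    · simp [proj_apply, hj]

/-- On tensors of vectors `w_i ∈ V_{f(i)}`, a morphism `σ : f ⟶ g` acts by permuting the
factors. -/
theorem groupoidAction_tprod {ℓ d : ℕ} (k : Fin ℓ → ℕ) {f g : Coloring ℓ d} (σ : f ⟶ g)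
    (w : Fin d → NatRep k) (hw : ∀ m, w m ∈ summand k (f.color m)) :
    groupoidAction k d (CatAlg.morph σ) (PiTensorProduct.tprod ℂ w) =
      PiTensorProduct.tprod ℂ fun m => w (σ.1⁻¹ m) := by
  rw [groupoidAction_morph]
  simp only [morphAction, LinearMap.comp_apply, tensorProj_tprod,
    fun m => (mem_summand_iff k _ _).1 (hw m), permuteFactors_tprod]
  rfl

/-- A morphism `σ : f ⟶ g` kills the tensors of vectors `w_i ∈ V_{f'(i)}`, if `f' ≠ f`. -/
theorem groupoidAction_tprod_ne {ℓ d : ℕ} (k : Fin ℓ → ℕ) {f g f' : Coloring ℓ d} (σ : f ⟶ g)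
    (hne : f ≠ f') (w : Fin d → NatRep k) (hw : ∀ m, w m ∈ summand k (f'.color m)) :
    groupoidAction k d (CatAlg.morph σ) (PiTensorProduct.tprod ℂ w) = 0 := by
  have h : PiTensorProduct.tprod ℂ w = tensorProj k f' (PiTensorProduct.tprod ℂ w) := by
    simp only [tensorProj_tprod, fun m => (mem_summand_iff k _ _).1 (hw m)]
  rw [groupoidAction_morph, h, morphAction, LinearMap.comp_apply, ← LinearMap.comp_apply
    (tensorProj k f), tensorProj_comp, if_neg hne]
  simp

end SchurWeyl

end

/-! The colorings index the characters `χ_f(x) = ∏ x_j ^ f(j)` of `C_ℓ ^ d`, and `S_d` permutes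
characters as it permutes colorings. So `xσ ↦ ∑_f χ_{fσ⁻¹}(x) σ_(f, fσ⁻¹)` is multiplicative on the
wreath product (`wreathHom`). Orthogonality of characters recovers each `e_f` from the image of `C_ℓ
^ d`, and every morphism out of `f` is a permutation times `e_f`. The map is therefore onto, and
both sides have dimension `ℓ ^ d * d!`.

For the duality, let `Y` commute with `A_(ℓ,d)`. It commutes with `S_d`, so averaging and
polarization write it as a combination of tensor powers of operators `y` on `V`
(`mem_span_map_const_of_commute`). It also commutes with the projections `e_f`, so `Y = ∑_f e_f Y
e_f`, and this compression replaces each `y` by its block-diagonal part. Block-diagonal operators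
are limits, in the polynomial sense of `diag_mem_of_generic`, of invertible ones, so `Y` lies in the
span of `GL_k`.

The other centralizer follows formally: `A_(ℓ,d)` is semisimple by Maschke's theorem, so its image
is its own double centralizer, by Jacobson density. -/

noncomputable section

namespace SchurWeyl

open CategoryTheory

/-! ### The isomorphism with the group algebra of the wreath product -/

/-! ### Products of morphisms, spanning set and dimension of a category algebra -/

namespace CatAlg

section

variable {C : Type*} [Category C] [DecidableEq C]

theorem coeff_morph {f g : C} (σ : f ⟶ g) :
    (morph σ).coeff f g = Finsupp.single σ 1 := by
  simp [morph]

theorem coeff_morph_of_ne_left {f g : C} (σ : f ⟶ g) {f' : C} (h : f' ≠ f) (g' : C) :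
    (morph σ).coeff f' g' = 0 := by
  simp [morph, Pi.single_eq_of_ne h]

theorem coeff_morph_of_ne_right {f g : C} (σ : f ⟶ g) {g' : C} (h : g' ≠ g) :
    (morph σ).coeff f g' = 0 := by
  simp [morph, Pi.single_eq_of_ne h]

variable [Fintype C]

theorem morph_mul_morph {f g h : C} (σ : f ⟶ g) (τ : g ⟶ h) :
    morph τ * morph σ = morph (σ ≫ τ) := by
  refine CatAlg.ext (funext₂ fun f' h' => ?_)
  rw [coeff_mul]
  by_cases hf : f' = f
  · subst hf
    rw [Finset.sum_eq_single g]
    · by_cases hh : h' = h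
      · subst hh
        simp [coeff_morph]
      · simp [coeff_morph_of_ne_right _ hh]
    · intro g' _ hg'
      simp [coeff_morph_of_ne_right _ hg']
    · simp
  · simp [coeff_morph_of_ne_left _ hf]

theorem morph_mul_morph_of_ne {f g g' h : C} (σ : f ⟶ g) (τ : g' ⟶ h) (hne : g' ≠ g) :
    morph τ * morph σ = 0 := by
  refine CatAlg.ext (funext₂ fun f' h' => ?_)
  rw [coeff_mul]
  refine Finset.sum_eq_zero fun i _ => ?_
  by_cases hf : f' = f
  · subst hf
    by_cases hi : i = g
    · subst hi
      simp [coeff_morph_of_ne_left _ hne.symm]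
    · simp [coeff_morph_of_ne_right _ hi]
  · simp [coeff_morph_of_ne_left _ hf]

theorem one_eq_sum_morph : (1 : CatAlg C) = ∑ f : C, morph (𝟙 f) := by
  have hsum (s : Finset C) (f g : C) :
      (∑ h ∈ s, morph (𝟙 h)).coeff f g = ∑ h ∈ s, (morph (𝟙 h)).coeff f g := by
    induction s using Finset.cons_induction with
    | empty => simp
    | cons a s ha ih => rw [Finset.sum_cons, Finset.sum_cons, coeff_add, ih]
  refine CatAlg.ext (funext₂ fun f g => ?_)
  rw [coeff_one, hsum, Finset.sum_eq_single f]
  · split_ifs with h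
    · subst h
      simp [coeff_morph]
    · rw [coeff_morph_of_ne_right _ (Ne.symm h)]
  · intro h _ hf
    rw [coeff_morph_of_ne_left _ hf.symm]
  · simp

end

section

variable {C : Type*} [Category C]

/-- The components of an element of the algebra of a category, as a linear equivalence. -/
def linearEquivPi (C : Type*) [Category C] : CatAlg C ≃ₗ[ℂ] (∀ f g : C, (f ⟶ g) →₀ ℂ) where
  __ := equivPi C
  map_add' _ _ := rfl
  map_smul' _ _ := rfl

/-- This reduces surjectivity onto the algebra, and commutation with its action, to single
morphisms. -/
theorem span_morph [Fintype C] [DecidableEq C] :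
    Submodule.span ℂ {a : CatAlg C | ∃ (f g : C) (σ : f ⟶ g), a = morph σ} = ⊤ := by
  have h (f g : C) (a : (f ⟶ g) →₀ ℂ) :
      (linearEquivPi C).symm (Pi.single f (Pi.single g a)) ∈
        Submodule.span ℂ {a : CatAlg C | ∃ (f g : C) (σ : f ⟶ g), a = morph σ} := by
    induction a using Finsupp.induction_linear with
    | zero =>
      rw [Pi.single_zero, Pi.single_zero, map_zero]
      exact Submodule.zero_mem _
    | add a b ha hb =>
      rw [Pi.single_add, Pi.single_add, map_add]
      exact Submodule.add_mem _ ha hb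
    | single σ r =>
      rw [← mul_one r, ← smul_eq_mul, ← Finsupp.smul_single, Pi.single_smul]
      rw [show (linearEquivPi C).symm (Pi.single f (r • Pi.single g (Finsupp.single σ 1))) =
        r • morph σ from ((linearEquivPi C).symm.toLinearMap ∘ₗ LinearMap.single ℂ _ f).map_smul r _]
      exact Submodule.smul_mem _ _ (Submodule.subset_span ⟨f, g, σ, rfl⟩)
  refine eq_top_iff.2 fun x _ => ?_
  rw [← (linearEquivPi C).symm_apply_apply x]
  generalize linearEquivPi C x = y
  rw [← Finset.univ_sum_single y, map_sum]
  refine Submodule.sum_mem _ fun f _ => ?_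
  rw [← Finset.univ_sum_single (y f)]
  change (linearEquivPi C).symm (LinearMap.single ℂ _ f _) ∈ _
  rw [map_sum, map_sum]
  exact Submodule.sum_mem _ fun g _ => h f g _

instance [Finite C] [∀ f g : C, Finite (f ⟶ g)] : Module.Finite ℂ (CatAlg C) :=
  Module.Finite.equiv (linearEquivPi C).symm

theorem finrank_eq [Fintype C] [∀ f g : C, Fintype (f ⟶ g)] :
    Module.finrank ℂ (CatAlg C) = ∑ f : C, ∑ g : C, Fintype.card (f ⟶ g) := by
  simp [(linearEquivPi C).finrank_eq, Module.finrank_pi_fintype]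

end

end CatAlg

/-! ### Morphisms of colorings as pairs of a source and a permutation -/

theorem Coloring.push_push {ℓ d : ℕ} (σ τ : Equiv.Perm (Fin d)) (f : Coloring ℓ d) :
    (f.push τ).push σ = f.push (σ * τ) := rfl

/-- Since the target is determined, it can be substituted away: a morphism amounts to its source and
its permutation. -/
theorem Coloring.hom_eq_push {ℓ d : ℕ} {f g : Coloring ℓ d} (σ : f ⟶ g) : g = f.push σ.1 := by
  refine Coloring.ext (funext fun i => ?_)
  simpa [push] using congrFun σ.2 (σ.1.symm i)

theorem morph_eq_morph_pushHom {ℓ d : ℕ} {f g : Coloring ℓ d} (σ : f ⟶ g) :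
    CatAlg.morph σ = CatAlg.morph (f.pushHom σ.1) := by
  obtain ⟨σ, hσ⟩ := σ
  have h : g = f.push σ := Coloring.hom_eq_push (⟨σ, hσ⟩ : f ⟶ g)
  subst h
  rfl

/-- The morphisms out of `f` are the permutations. -/
def Coloring.sigmaHomEquiv {ℓ d : ℕ} (f : Coloring ℓ d) :
    (Σ g : Coloring ℓ d, (f ⟶ g)) ≃ Equiv.Perm (Fin d) where
  toFun σ := σ.2.1
  invFun σ := ⟨f.push σ, f.pushHom σ⟩
  left_inv := by
    rintro ⟨g, σ, hσ⟩
    have h : g = f.push σ := Coloring.hom_eq_push (⟨σ, hσ⟩ : f ⟶ g)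
    subst h
    rfl
  right_inv _ := rfl

instance {ℓ d : ℕ} (f g : Coloring ℓ d) : Finite (f ⟶ g) :=
  inferInstanceAs (Finite {σ : Equiv.Perm (Fin d) // g.color ∘ σ = f.color})

theorem finrank_groupoidAlg (ℓ d : ℕ) :
    Module.finrank ℂ (GroupoidAlg ℓ d) = ℓ ^ d * d.factorial := by
  classical
  have (f g : Coloring ℓ d) : Fintype (f ⟶ g) := Fintype.ofFinite _
  rw [CatAlg.finrank_eq]
  have h (f : Coloring ℓ d) : ∑ g, Fintype.card (f ⟶ g) = d.factorial := by
    rw [← Fintype.card_sigma, Fintype.card_congr f.sigmaHomEquiv, Fintype.card_perm,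
      Fintype.card_fin]
  simp [h, Fintype.card_congr (Coloring.equivFun ℓ d)]

/-- The character of `C_ℓ ^ d` attached to a coloring. -/
def colorChar {ℓ d : ℕ} (f : Coloring ℓ d) (x : Fin d → rootsOfUnity ℓ ℂ) : ℂ :=
  -- The elements of `Fin ℓ` start at `0`, while the colors are `1, …, ℓ`; hence the shift in the
  -- exponent.
  ∏ j, ((x j : ℂˣ) : ℂ) ^ ((f.color j : ℕ) + 1)

theorem colorChar_mul {ℓ d : ℕ} (f : Coloring ℓ d) (x y : Fin d → rootsOfUnity ℓ ℂ) :
    colorChar f (x * y) = colorChar f x * colorChar f y := by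
  simp [colorChar, mul_pow, Finset.prod_mul_distrib]

theorem colorChar_one {ℓ d : ℕ} (f : Coloring ℓ d) : colorChar f 1 = 1 := by
  simp [colorChar]

/-- Coloring and argument are both precomposed with `σ⁻¹`, so the product is only reindexed. This
matches the relation of the semidirect product and makes `wreathHom` multiplicative. -/
theorem colorChar_push {ℓ d : ℕ} (f : Coloring ℓ d) (σ : Equiv.Perm (Fin d))
    (x : Fin d → rootsOfUnity ℓ ℂ) :
    colorChar (f.push σ) (mulAutArrow σ x) = colorChar f x := by
  refine Fintype.prod_equiv σ.symm _ _ fun j => ?_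
  rfl

/-- The embedding of the wreath product in the groupoid algebra. -/
def wreathHom (ℓ d : ℕ) : GenSym ℓ d →* GroupoidAlg ℓ d where
  toFun s := ∑ f : Coloring ℓ d,
    -- In `xσ` the diagonal part `x` acts after `σ`, so its character is taken at the target of `σ`.
    colorChar (f.push s.right) s.left • CatAlg.morph (f.pushHom s.right)
  map_one' := by
    rw [CatAlg.one_eq_sum_morph]
    refine Finset.sum_congr rfl fun f _ => ?_
    rw [SemidirectProduct.one_left, colorChar_one, one_smul]
    rfl
  map_mul' s t := by
    rw [Finset.sum_mul_sum, Finset.sum_comm]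
    refine Finset.sum_congr rfl fun g _ => ?_
    rw [Finset.sum_eq_single (g.push t.right)]
    · rw [smul_mul_smul_comm, CatAlg.morph_mul_morph, SemidirectProduct.mul_left, colorChar_mul,
        ← colorChar_push (g.push t.right) s.right t.left]
      rfl
    · intro f _ hf
      rw [smul_mul_smul_comm, CatAlg.morph_mul_morph_of_ne _ _ hf, smul_zero]
    · simp

theorem wreathHom_inr {ℓ d : ℕ} (σ : Equiv.Perm (Fin d)) :
    wreathHom ℓ d (SemidirectProduct.inr σ) =
      ∑ f : Coloring ℓ d, CatAlg.morph (f.pushHom σ) := by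
  refine Finset.sum_congr rfl fun f _ => ?_
  rw [SemidirectProduct.left_inr, colorChar_one, one_smul]
  rfl

theorem wreathHom_inl {ℓ d : ℕ} (x : Fin d → rootsOfUnity ℓ ℂ) :
    wreathHom ℓ d (SemidirectProduct.inl x) =
      ∑ f : Coloring ℓ d, colorChar f x • CatAlg.morph (𝟙 f) :=
  rfl

theorem colorChar_mulSingle {ℓ d : ℕ} (f : Coloring ℓ d) (j : Fin d) (ξ : rootsOfUnity ℓ ℂ) :
    colorChar f (Pi.mulSingle j ξ) = ((ξ : ℂˣ) : ℂ) ^ ((f.color j : ℕ) + 1) := by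
  rw [colorChar, Finset.prod_eq_single j]
  · simp
  · intro i _ hi
    simp [Pi.mulSingle_eq_of_ne hi]
  · simp

/-! ### Orthogonality of characters and bijectivity -/

instance (ℓ : ℕ) [NeZero ℓ] : Fintype (rootsOfUnity ℓ ℂ) := Fintype.ofFinite _

/-- Translating the summation variable by a primitive root `ξ` multiplies the sum by `ξ ^ (a - b)`,
which differs from `1` when `a ≠ b`, so the sum vanishes. -/
theorem sum_rootsOfUnity_pow {ℓ : ℕ} [NeZero ℓ] (a b : Fin ℓ) :
    ∑ z : rootsOfUnity ℓ ℂ, ((z : ℂˣ) : ℂ) ^ ((a : ℕ) + 1) * (((z : ℂˣ) : ℂ) ^ ((b : ℕ) + 1))⁻¹ =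
      if a = b then (ℓ : ℂ) else 0 := by
  split_ifs with h
  · subst h
    have h0 (z : rootsOfUnity ℓ ℂ) : ((z : ℂˣ) : ℂ) ≠ 0 := Units.ne_zero _
    simp only [mul_inv_cancel₀ (pow_ne_zero _ (h0 _)), Finset.sum_const, Finset.card_univ,
      ← Nat.card_eq_fintype_card, Complex.card_rootsOfUnity, nsmul_eq_mul, mul_one]
  · have hξ := Complex.isPrimitiveRoot_exp ℓ (NeZero.ne ℓ)
    set ξ := hξ.toRootsOfUnity with hξdef
    have hξ0 : (((ξ : ℂˣ) : ℂ)) ≠ 0 := Units.ne_zero _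
    rw [← IsPrimitiveRoot.val_toRootsOfUnity_coe hξ, ← hξdef] at hξ
    set S := ∑ z : rootsOfUnity ℓ ℂ,
      ((z : ℂˣ) : ℂ) ^ ((a : ℕ) + 1) * (((z : ℂˣ) : ℂ) ^ ((b : ℕ) + 1))⁻¹ with hS
    have hmul : S = ((ξ : ℂˣ) : ℂ) ^ ((a : ℕ) + 1) * (((ξ : ℂˣ) : ℂ) ^ ((b : ℕ) + 1))⁻¹ * S := by
      conv_lhs => rw [hS, ← Equiv.sum_comp (Equiv.mulLeft ξ)]
      rw [hS, Finset.mul_sum]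
      refine Finset.sum_congr rfl fun z _ => ?_
      simp only [Equiv.coe_mulLeft, Subgroup.coe_mul, Units.val_mul, mul_pow, mul_inv]
      ring
    by_contra hS0
    have h1 := mul_right_cancel₀ hS0 ((one_mul S).trans hmul)
    rw [eq_mul_inv_iff_mul_eq₀ (pow_ne_zero _ hξ0), one_mul, pow_succ, pow_succ] at h1
    exact h (Fin.ext (hξ.pow_inj a.2 b.2 (mul_right_cancel₀ hξ0 h1).symm))

/-- Distributivity factors the sum over `C_ℓ ^ d` into `d` one-variable orthogonality relations; one
place where the colors differ kills the product. -/
theorem sum_colorChar {ℓ d : ℕ} [NeZero ℓ] (f g : Coloring ℓ d) :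
    ∑ x : Fin d → rootsOfUnity ℓ ℂ, colorChar g x * (colorChar f x)⁻¹ =
      if g = f then (ℓ : ℂ) ^ d else 0 := by
  have h := (Finset.prod_univ_sum (fun _ : Fin d => (Finset.univ : Finset (rootsOfUnity ℓ ℂ)))
    fun j z => ((z : ℂˣ) : ℂ) ^ ((g.color j : ℕ) + 1) *
      (((z : ℂˣ) : ℂ) ^ ((f.color j : ℕ) + 1))⁻¹).symm
  rw [Fintype.piFinset_univ] at h
  simp only [Finset.prod_mul_distrib, Finset.prod_inv_distrib, sum_rootsOfUnity_pow] at h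
  refine h.trans ?_
  split_ifs with hgf
  · subst hgf
    simp
  · obtain ⟨j, hj⟩ : ∃ j, g.color j ≠ f.color j := by
      by_contra! hc
      exact hgf (Coloring.ext (funext hc))
    exact Finset.prod_eq_zero (Finset.mem_univ j) (if_neg hj)

/-- Fourier inversion on `C_ℓ ^ d`: up to the factor `ℓ ^ d`, the idempotent of the character `χ_f`
maps to `e_f`. -/
theorem sum_wreathHom_inl {ℓ d : ℕ} [NeZero ℓ] (f : Coloring ℓ d) :
    ∑ x : Fin d → rootsOfUnity ℓ ℂ,
      (colorChar f x)⁻¹ • wreathHom ℓ d (SemidirectProduct.inl x) =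
        ((ℓ : ℂ) ^ d) • CatAlg.morph (𝟙 f) := by
  simp only [wreathHom_inl, Finset.smul_sum, smul_smul]
  rw [Finset.sum_comm]
  simp only [← Finset.sum_smul, mul_comm (colorChar f _)⁻¹, sum_colorChar, ite_smul, zero_smul]
  simp

instance (ℓ d : ℕ) [NeZero ℓ] : Finite (GenSym ℓ d) :=
  Finite.of_equiv _ SemidirectProduct.equivProd.symm

/-- The range contains every `e_f` by Fourier inversion, and multiplying `e_f` by the image of a
permutation isolates one morphism out of `f`. -/
theorem lift_wreathHom_surjective (ℓ d : ℕ) [NeZero ℓ] :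
    Function.Surjective (MonoidAlgebra.lift ℂ _ _ (wreathHom ℓ d)) := by
  have hinl (s : GenSym ℓ d) :
      wreathHom ℓ d s ∈ (MonoidAlgebra.lift ℂ _ _ (wreathHom ℓ d)).range :=
    ⟨MonoidAlgebra.of ℂ _ s, MonoidAlgebra.lift_of ..⟩
  have hid (f : Coloring ℓ d) :
      CatAlg.morph (𝟙 f) ∈ (MonoidAlgebra.lift ℂ _ _ (wreathHom ℓ d)).range := by
    have h0 : (ℓ : ℂ) ^ d ≠ 0 := pow_ne_zero _ (Nat.cast_ne_zero.2 (NeZero.ne ℓ))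
    rw [← inv_smul_smul₀ h0 (CatAlg.morph (𝟙 f)), ← sum_wreathHom_inl]
    exact Subalgebra.smul_mem _ (Subalgebra.sum_mem _ fun x _ =>
      Subalgebra.smul_mem _ (hinl _) _) _
  have hmorph {f g : Coloring ℓ d} (σ : f ⟶ g) :
      CatAlg.morph σ ∈ (MonoidAlgebra.lift ℂ _ _ (wreathHom ℓ d)).range := by
    have : CatAlg.morph σ = wreathHom ℓ d (SemidirectProduct.inr σ.1) * CatAlg.morph (𝟙 f) := by
      rw [wreathHom_inr, Finset.sum_mul, Finset.sum_eq_single f]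
      · rw [CatAlg.morph_mul_morph, Category.id_comp, morph_eq_morph_pushHom]
      · intro g _ hg
        rw [CatAlg.morph_mul_morph_of_ne _ _ hg]
      · simp
    rw [this]
    exact Subalgebra.mul_mem _ (hinl _) (hid f)
  intro a
  have ha : a ∈ Submodule.span ℂ
      {a : GroupoidAlg ℓ d | ∃ (f g : Coloring ℓ d) (σ : f ⟶ g), a = CatAlg.morph σ} := by
    rw [CatAlg.span_morph]
    trivial
  refine (Submodule.span_le (p := Subalgebra.toSubmodule
    (MonoidAlgebra.lift ℂ _ _ (wreathHom ℓ d)).range)).2 ?_ ha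
  rintro _ ⟨f, g, σ, rfl⟩
  exact hmorph σ

theorem finrank_monoidAlgebra_genSym (ℓ d : ℕ) [NeZero ℓ] :
    Module.finrank ℂ (MonoidAlgebra ℂ (GenSym ℓ d)) = ℓ ^ d * d.factorial := by
  rw [Module.finrank_eq_nat_card_basis (MonoidAlgebra.basis (GenSym ℓ d) ℂ),
    SemidirectProduct.card, Nat.card_pi]
  simp only [Complex.card_rootsOfUnity, Finset.prod_const, Finset.card_univ, Fintype.card_fin,
    Nat.card_eq_fintype_card (α := Equiv.Perm (Fin d)), Fintype.card_perm]

/-- The group algebra of the wreath product is isomorphic to the groupoid algebra. -/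
def wreathEquiv (ℓ d : ℕ) [NeZero ℓ] :
    MonoidAlgebra ℂ (GenSym ℓ d) ≃ₐ[ℂ] GroupoidAlg ℓ d :=
  AlgEquiv.ofBijective (MonoidAlgebra.lift ℂ _ _ (wreathHom ℓ d))
    ⟨(LinearMap.injective_iff_surjective_of_finrank_eq_finrank
        (f := (MonoidAlgebra.lift ℂ _ _ (wreathHom ℓ d)).toLinearMap)
        ((finrank_monoidAlgebra_genSym ℓ d).trans (finrank_groupoidAlg ℓ d).symm)).2
        (lift_wreathHom_surjective ℓ d),
      lift_wreathHom_surjective ℓ d⟩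

theorem wreathEquiv_of {ℓ d : ℕ} [NeZero ℓ] (s : GenSym ℓ d) :
    wreathEquiv ℓ d (MonoidAlgebra.of ℂ _ s) = wreathHom ℓ d s :=
  MonoidAlgebra.lift_of ..

/-- Maschke's theorem for the wreath product, whose order is nonzero in `ℂ`, transported along the
isomorphism. -/
instance (ℓ d : ℕ) [NeZero ℓ] : IsSemisimpleRing (GroupoidAlg ℓ d) := by
  have : NeZero (Nat.card (GenSym ℓ d) : ℂ) := ⟨Nat.cast_ne_zero.2 Nat.card_pos.ne'⟩
  exact (wreathEquiv ℓ d).toRingEquiv.isSemisimpleRing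

end SchurWeyl

/-! ### The double centralizer theorem -/

/-- An operator in the double centralizer is linear over `End_R W`. As `W` is a semisimple
`R`-module, Jacobson density finds an element of `R` that agrees with the operator on any given
finite set; a finite spanning set over `K` suffices. -/
theorem Subalgebra.centralizer_centralizer_range_of_isSemisimpleRing {K R W : Type*} [Field K]
    [Ring R] [Algebra K R] [IsSemisimpleRing R] [AddCommGroup W] [Module K W] [Module.Finite K W]
    (φ : R →ₐ[K] Module.End K W) :
    Subalgebra.centralizer K (Subalgebra.centralizer K (Set.range φ) : Set (Module.End K W)) =
      φ.range := by
  refine le_antisymm (fun X hX => ?_) (Subalgebra.le_centralizer_centralizer K (s := φ.range))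
  let _ : Module R W := Module.compHom W φ.toRingHom
  have hsmul (r : R) (w : W) : r • w = φ r w := rfl
  -- Scalars of `K` act through `R`, so `R`-linear maps are `K`-linear and belong to the centralizer
  -- of the range.
  have hlin (f : Module.End R W) (c : K) (w : W) : f (c • w) = c • f w := by
    have h := f.map_smul (algebraMap K R c) w
    simpa [hsmul] using h
  let toK (f : Module.End R W) : Module.End K W :=
    { toFun := f, map_add' := f.map_add, map_smul' := hlin f }
  have htoK (f : Module.End R W) : toK f ∈ Subalgebra.centralizer K (Set.range φ) := by
    rintro _ ⟨r, rfl⟩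
    exact LinearMap.ext fun w => (f.map_smul r w).symm
  let F : Module.End (Module.End R W) W :=
    { toFun := X
      map_add' := X.map_add
      map_smul' := fun f w => (LinearMap.congr_fun (hX (toK f) (htoK f)) w).symm }
  obtain ⟨s, hs⟩ := (Module.Finite.fg_top : (⊤ : Submodule K W).FG)
  obtain ⟨r, hr⟩ := jacobson_density F s
  exact ⟨r, LinearMap.ext_on hs fun m hm => (hr m hm).symm⟩

/-! ### Polarization and density for multilinear maps -/

namespace MultilinearMap

open Finset in
/-- The polarization identity for the symmetrization of a multilinear map. -/
theorem sum_perm_eq_sum_finset {R ι E F : Type*} [CommRing R] [Fintype ι] [DecidableEq ι]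
    [AddCommGroup E] [Module R E] [AddCommGroup F] [Module R F]
    (T : MultilinearMap R (fun _ : ι => E) F) (x : ι → E) :
    ∑ σ : Equiv.Perm ι, T (fun i => x (σ i)) =
      ∑ s : Finset ι, (-1 : ℤ) ^ #s • T fun _ => ∑ i ∈ sᶜ, x i := by
  -- In the multilinear expansion, the index functions `r` with values in `sᶜ` are those with `s`
  -- inside the complement of the image of `r`.
  have hexp (s : Finset ι) : T (fun _ => ∑ i ∈ sᶜ, x i) =
      ∑ r : ι → ι, if s ⊆ (univ.image r)ᶜ then T (fun i => x (r i)) else 0 := by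
    rw [T.map_sum_finset (fun _ i => x i) fun _ => sᶜ, ← sum_filter]
    refine sum_congr ?_ fun _ _ => rfl
    ext r
    simp only [Fintype.mem_piFinset, mem_compl, mem_filter, mem_univ, true_and, subset_iff,
      mem_image, not_exists]
    grind
  -- Inclusion-exclusion: the signs over the subsets of the complement of the image cancel unless
  -- that complement is empty, that is, unless `r` is a permutation.
  have hinner (r : ι → ι) :
      ∑ s : Finset ι, (-1 : ℤ) ^ #s • (if s ⊆ (univ.image r)ᶜ then T (fun i => x (r i)) else 0) =
        if Function.Bijective r then T (fun i => x (r i)) else 0 := by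
    have hcard := sum_powerset_neg_one_pow_card (x := (univ.image r)ᶜ)
    have hfilter : ({s | s ⊆ (univ.image r)ᶜ} : Finset (Finset ι)) = (univ.image r)ᶜ.powerset := by
      ext s; simp
    have hiff : (univ.image r)ᶜ = ∅ ↔ Function.Bijective r := by
      rw [compl_eq_empty_iff, ← Finset.coe_eq_univ, coe_image, coe_univ, Set.image_univ,
        Set.range_eq_univ, Finite.surjective_iff_bijective]
    simp only [smul_ite, smul_zero]
    rw [← sum_filter, ← sum_smul, hfilter, hcard]
    simp only [hiff, ite_smul, one_smul, zero_smul]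
  simp only [hexp, smul_sum]
  rw [sum_comm]
  simp only [hinner]
  rw [← sum_filter]
  refine sum_bij (fun σ _ => σ) (fun σ _ => by simp)
    (fun _ _ _ _ h => Equiv.coe_fn_injective h) (fun r hr => ?_) fun _ _ => rfl
  exact ⟨Equiv.ofBijective r (by simpa using hr), mem_univ _, rfl⟩

theorem sum_perm_mem_span {K ι E F : Type*} [Field K] [Fintype ι] [DecidableEq ι]
    [AddCommGroup E] [Module K E] [AddCommGroup F] [Module K F]
    (T : MultilinearMap K (fun _ : ι => E) F) (x : ι → E) :
    ∑ σ : Equiv.Perm ι, T (fun i => x (σ i)) ∈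
      Submodule.span K (Set.range fun y : E => T fun _ => y) := by
  rw [sum_perm_eq_sum_finset]
  refine Submodule.sum_mem _ fun s _ => Submodule.smul_of_tower_mem _ _ ?_
  exact Submodule.subset_span ⟨∑ i ∈ sᶜ, x i, rfl⟩

/-- If `T (a + t e, …, a + t e)` belongs to `W` for generic `t`, then so does `T (a, …, a)`. -/
theorem diag_mem_of_generic {K ι E F : Type*} [Field K] [Infinite K] [Fintype ι]
    [AddCommGroup E] [Module K E] [AddCommGroup F] [Module K F]
    (T : MultilinearMap K (fun _ : ι => E) F) (W : Submodule K F) (a e : E) (q : Polynomial K)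
    (hq : q ≠ 0) (h : ∀ t, q.eval t ≠ 0 → T (fun _ => a + t • e) ∈ W) :
    T (fun _ => a) ∈ W := by
  classical
  by_contra hW
  -- A functional that vanishes on `W` but not at `T (a, …, a)` reduces the claim to one about the
  -- scalar polynomial `t ↦ φ (T (a + t e, …, a + t e))`.
  obtain ⟨φ, hφ, hle⟩ := Submodule.exists_le_ker_of_notMem hW
  let p : Polynomial K := ∑ s : Finset ι,
    Polynomial.C (φ (T (s.piecewise (fun _ => a) fun _ => e))) * Polynomial.X ^ sᶜ.card
  have hp (t : K) : p.eval t = φ (T fun _ => a + t • e) := by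
    have hpiece (s : Finset ι) : T (s.piecewise (fun _ => a) fun _ => t • e) =
        t ^ sᶜ.card • T (s.piecewise (fun _ => a) fun _ => e) := by
      rw [← Finset.prod_const, ← T.map_piecewise_smul (fun _ => t)]
      congr 1
      funext i
      by_cases hi : i ∈ s <;> simp [hi]
    have hadd := T.map_add_univ (fun _ => a) fun _ => t • e
    rw [show (fun _ => a + t • e : ι → E) = (fun _ => a) + fun _ => t • e from rfl, hadd,
      _root_.map_sum, Polynomial.eval_finsetSum]
    refine Finset.sum_congr rfl fun s _ => ?_
    rw [hpiece, map_smul, smul_eq_mul, mul_comm, Polynomial.eval_mul, Polynomial.eval_C,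
      Polynomial.eval_pow, Polynomial.eval_X]
  -- `p` vanishes wherever `q` does not, so `p * q` vanishes at every point of an infinite field;
  -- then `p = 0`, and its value at `0` gives the contradiction.
  have hpq : p * q = 0 := by
    refine Polynomial.funext fun t => ?_
    by_cases ht : q.eval t = 0
    · simp [ht]
    · simp [hp, LinearMap.mem_ker.1 (hle (h t ht))]
  have hp0 := (mul_eq_zero.1 hpq).resolve_right hq
  have h0 := hp 0
  simp only [hp0, Polynomial.eval_zero, zero_smul, add_zero] at h0
  exact hφ h0.symm

end MultilinearMap

/-- The matrix units of a tensor product basis are tensor products of matrix units. -/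
theorem PiTensorProduct.span_range_map_eq_top {K ι V : Type*} [Field K] [Finite ι]
    [AddCommGroup V] [Module K V] [Module.Finite K V] :
    Submodule.span K (Set.range fun x : ι → Module.End K V =>
      (PiTensorProduct.map x : Module.End K (⨂[K] _ : ι, V))) = ⊤ := by
  classical
  have := Fintype.ofFinite ι
  let b := Module.finBasis K V
  let B := Basis.piTensorProduct fun _ : ι => b
  rw [eq_top_iff, ← (B.linearMap B).span_eq, Submodule.span_le]
  rintro _ ⟨⟨i, j⟩, rfl⟩
  refine Submodule.subset_span ⟨fun m => b.linearMap b (i m, j m), B.ext fun l => ?_⟩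
  rw [Module.Basis.linearMap_apply_apply]
  simp only [B, Basis.piTensorProduct_apply, PiTensorProduct.map_tprod,
    Module.Basis.linearMap_apply_apply]
  split_ifs with h
  · simp [h]
  · obtain ⟨m, hm⟩ := Function.ne_iff.1 h
    exact (PiTensorProduct.tprod K).map_coord_zero m (if_neg hm)

namespace SchurWeyl

open CategoryTheory

/-! ### The action of the symmetric group -/

theorem permuteFactors_comp_map {ℓ d : ℕ} (k : Fin ℓ → ℕ) (σ : Equiv.Perm (Fin d))
    (x : Fin d → Module.End ℂ (NatRep k)) :
    permuteFactors k σ ∘ₗ PiTensorProduct.map x =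
      PiTensorProduct.map (fun m => x (σ.symm m)) ∘ₗ permuteFactors k σ := by
  refine PiTensorProduct.ext (MultilinearMap.ext fun v => ?_)
  simp only [LinearMap.compMultilinearMap_apply, LinearMap.comp_apply, permuteFactors_tprod,
    PiTensorProduct.map_tprod]

/-- The tensor product of endomorphisms of `V`, as a multilinear map. -/
def tensorEnd {ℓ : ℕ} (k : Fin ℓ → ℕ) (d : ℕ) :
    MultilinearMap ℂ (fun _ : Fin d => Module.End ℂ (NatRep k)) (Module.End ℂ (TensorSpace k d)) :=
  PiTensorProduct.mapMultilinear ℂ _ _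

theorem permuteFactors_one {ℓ d : ℕ} (k : Fin ℓ → ℕ) :
    permuteFactors k (1 : Equiv.Perm (Fin d)) = LinearMap.id := by
  refine PiTensorProduct.ext (MultilinearMap.ext fun v => ?_)
  simp only [LinearMap.compMultilinearMap_apply, permuteFactors_tprod]
  rfl

theorem tensorEnd_apply {ℓ d : ℕ} (k : Fin ℓ → ℕ) (x : Fin d → Module.End ℂ (NatRep k)) :
    tensorEnd k d x = PiTensorProduct.map x := rfl

theorem sum_perm_map_mem_span {ℓ d : ℕ} (k : Fin ℓ → ℕ) (x : Fin d → Module.End ℂ (NatRep k)) :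
    ∑ σ : Equiv.Perm (Fin d),
        (PiTensorProduct.map (fun m => x (σ m)) : Module.End ℂ (TensorSpace k d)) ∈
      Submodule.span ℂ (Set.range fun y : Module.End ℂ (NatRep k) =>
        (PiTensorProduct.map fun _ => y : Module.End ℂ (TensorSpace k d))) := by
  have h := MultilinearMap.sum_perm_mem_span (K := ℂ) (E := Module.End ℂ (NatRep k))
    (F := Module.End ℂ (TensorSpace k d)) (tensorEnd k d) x
  simpa only [tensorEnd_apply] using h

/-- The operators commuting with the symmetric group are spanned by the tensor powers. -/
theorem mem_span_map_const_of_commute {ℓ d : ℕ} (k : Fin ℓ → ℕ)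
    (Y : Module.End ℂ (TensorSpace k d))
    (hY : ∀ σ : Equiv.Perm (Fin d), permuteFactors k σ ∘ₗ Y = Y ∘ₗ permuteFactors k σ) :
    Y ∈ Submodule.span ℂ (Set.range fun y : Module.End ℂ (NatRep k) =>
      (PiTensorProduct.map fun _ => y : Module.End ℂ (TensorSpace k d))) := by
  -- The unnormalized average over conjugation by `S_d`. It multiplies `Y` by `d!` and symmetrizes
  -- tensor products of operators, and polarization puts these symmetrizations in the required span.
  let avg : Module.End ℂ (TensorSpace k d) →ₗ[ℂ] Module.End ℂ (TensorSpace k d) :=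
    ∑ σ : Equiv.Perm (Fin d),
      LinearMap.mulLeft ℂ (permuteFactors k σ : Module.End ℂ (TensorSpace k d)) ∘ₗ
        LinearMap.mulRight ℂ (permuteFactors k σ⁻¹ : Module.End ℂ (TensorSpace k d))
  have happ (Z : Module.End ℂ (TensorSpace k d)) :
      avg Z = ∑ σ : Equiv.Perm (Fin d),
        permuteFactors k σ ∘ₗ (Z ∘ₗ permuteFactors k σ⁻¹) := by
    simp only [avg, LinearMap.sum_apply]
    rfl
  have havg : avg Y = (d.factorial : ℂ) • Y := by
    have h (σ : Equiv.Perm (Fin d)) : permuteFactors k σ ∘ₗ (Y ∘ₗ permuteFactors k σ⁻¹) = Y := by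
      rw [← LinearMap.comp_assoc, hY, LinearMap.comp_assoc, permute_comp, mul_inv_cancel,
        permuteFactors_one, LinearMap.comp_id]
    simp only [happ, h, Finset.sum_const, Finset.card_univ, Fintype.card_perm, Fintype.card_fin,
      Nat.cast_smul_eq_nsmul]
  have hmap (x : Fin d → Module.End ℂ (NatRep k)) :
      avg (PiTensorProduct.map x) =
        ∑ σ : Equiv.Perm (Fin d), PiTensorProduct.map fun m => x (σ m) := by
    rw [happ]
    -- Conjugation by `σ` permutes the factors through `σ⁻¹`, so the sum is reindexed by inversion.
    refine Fintype.sum_equiv (Equiv.inv _) _ _ fun σ => ?_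
    rw [← LinearMap.comp_assoc, permuteFactors_comp_map, LinearMap.comp_assoc, permute_comp,
      mul_inv_cancel, permuteFactors_one, LinearMap.comp_id]
    rfl
  have hmem (Z : Module.End ℂ (TensorSpace k d)) :
      avg Z ∈ Submodule.span ℂ (Set.range fun y : Module.End ℂ (NatRep k) =>
        (PiTensorProduct.map fun _ => y : Module.End ℂ (TensorSpace k d))) := by
    have hle : Submodule.span ℂ (Set.range fun x : Fin d → Module.End ℂ (NatRep k) =>
        (PiTensorProduct.map x : Module.End ℂ (TensorSpace k d))) ≤
        (Submodule.span ℂ (Set.range fun y : Module.End ℂ (NatRep k) =>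
          (PiTensorProduct.map fun _ => y : Module.End ℂ (TensorSpace k d)))).comap avg := by
      refine Submodule.span_le.2 ?_
      rintro _ ⟨x, rfl⟩
      rw [SetLike.mem_coe, Submodule.mem_comap, hmap]
      exact sum_perm_map_mem_span k x
    rw [PiTensorProduct.span_range_map_eq_top] at hle
    exact hle trivial
  have h0 : (d.factorial : ℂ) ≠ 0 := Nat.cast_ne_zero.2 d.factorial_ne_zero
  rw [← inv_smul_smul₀ h0 Y, ← havg]
  exact Submodule.smul_mem _ _ (hmem Y)

/-! ### Block diagonal matrices -/

/-- The operator on `V` given by a family of square matrices, on the summands `V_i`. -/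
def blockOp {ℓ : ℕ} (k : Fin ℓ → ℕ) (N : ∀ i, Matrix (Fin (k i)) (Fin (k i)) ℂ) :
    Module.End ℂ (NatRep k) :=
  Matrix.mulVecLin (Matrix.reindex finSigmaFinEquiv finSigmaFinEquiv (Matrix.blockDiagonal' N))

theorem blockOp_single {ℓ : ℕ} (k : Fin ℓ → ℕ) (N : ∀ i, Matrix (Fin (k i)) (Fin (k i)) ℂ)
    (p q : Σ i, Fin (k i)) :
    blockOp k N (Pi.single (finSigmaFinEquiv q) 1) (finSigmaFinEquiv p) =
      Matrix.blockDiagonal' N p q := by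
  simp [blockOp]

theorem block_finSigmaFinEquiv {ℓ : ℕ} (k : Fin ℓ → ℕ) (p : Σ i, Fin (k i)) :
    block k (finSigmaFinEquiv p) = p.1 := by
  simp [block]

theorem proj_single {ℓ : ℕ} (k : Fin ℓ → ℕ) (i : Fin ℓ) (j : Fin (∑ i, k i)) :
    proj k i (Pi.single j 1) = if block k j = i then Pi.single j 1 else 0 := by
  funext j'
  rw [proj_apply]
  by_cases h : j' = j
  · subst h; split_ifs <;> simp
  · simp [h, apply_ite (fun v : NatRep k => v j')]

theorem end_ext {ℓ : ℕ} {k : Fin ℓ → ℕ} {x y : Module.End ℂ (NatRep k)}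
    (h : ∀ p q : Σ i, Fin (k i),
      x (Pi.single (finSigmaFinEquiv q) 1) (finSigmaFinEquiv p) =
        y (Pi.single (finSigmaFinEquiv q) 1) (finSigmaFinEquiv p)) : x = y := by
  refine (Pi.basisFun ℂ _).ext fun j => funext fun j' => ?_
  obtain ⟨q, rfl⟩ := finSigmaFinEquiv.surjective j
  obtain ⟨p, rfl⟩ := finSigmaFinEquiv.surjective j'
  simpa using h p q

theorem proj_comp_blockOp {ℓ : ℕ} (k : Fin ℓ → ℕ) (N : ∀ i, Matrix (Fin (k i)) (Fin (k i)) ℂ)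
    (i : Fin ℓ) : proj k i ∘ₗ blockOp k N = blockOp k N ∘ₗ proj k i := by
  refine end_ext fun p q => ?_
  rw [LinearMap.comp_apply, LinearMap.comp_apply, proj_apply, proj_single, blockOp_single,
    block_finSigmaFinEquiv, block_finSigmaFinEquiv]
  by_cases hpq : p.1 = q.1
  · rw [hpq]
    split_ifs <;> simp [blockOp_single]
  · have h0 : Matrix.blockDiagonal' N p q = 0 := Matrix.blockDiagonal'_apply_ne N _ _ hpq
    rw [h0]
    split_ifs <;> simp [blockOp_single, h0]

/-- The compression erases the entries between different blocks and keeps the others; this brings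
arbitrary operators on `V` to block-diagonal form. -/
theorem sum_proj_comp_proj_eq_blockOp {ℓ : ℕ} (k : Fin ℓ → ℕ) (y : Module.End ℂ (NatRep k)) :
    ∑ i, proj k i ∘ₗ y ∘ₗ proj k i = blockOp k fun i => Matrix.of fun a b =>
      y (Pi.single (finSigmaFinEquiv ⟨i, b⟩) 1) (finSigmaFinEquiv ⟨i, a⟩) := by
  refine end_ext fun ⟨i, a⟩ ⟨j, b⟩ => ?_
  rw [blockOp_single, LinearMap.sum_apply, Finset.sum_apply, Finset.sum_eq_single i]
  · rw [LinearMap.comp_apply, LinearMap.comp_apply, proj_apply, proj_single,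
      block_finSigmaFinEquiv, block_finSigmaFinEquiv, if_pos rfl]
    by_cases h : i = j
    · subst h
      rw [if_pos rfl, Matrix.blockDiagonal'_apply_eq]
      rfl
    · rw [if_neg (Ne.symm h), Matrix.blockDiagonal'_apply_ne _ _ _ h]
      simp
  · intro m _ hm
    rw [LinearMap.comp_apply, proj_apply, block_finSigmaFinEquiv, if_neg hm.symm]
  · simp

/-- The line through a block-diagonal operator in the direction of the identity stays
block-diagonal; along it a singular operator is perturbed to invertible ones. -/
theorem blockOp_add_smul_one {ℓ : ℕ} (k : Fin ℓ → ℕ)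
    (N : ∀ i, Matrix (Fin (k i)) (Fin (k i)) ℂ) (t : ℂ) :
    blockOp k (fun i => N i + t • 1) = blockOp k N + t • LinearMap.id := by
  have h : Matrix.blockDiagonal' (fun i => N i + t • 1) = Matrix.blockDiagonal' N + t • 1 := by
    rw [← Matrix.blockDiagonal'_one, ← Matrix.blockDiagonal'_smul, ← Matrix.blockDiagonal'_add]
    rfl
  rw [blockOp, h, blockOp]
  simp [Matrix.submatrix_add, Matrix.submatrix_smul]

/-! ### Operators commuting with the groupoid algebra -/

theorem glAction_apply {ℓ d : ℕ} (k : Fin ℓ → ℕ) (u : ∀ i, GL (Fin (k i)) ℂ) :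
    glAction k d ⟨diagGL k u, u, rfl⟩ =
      PiTensorProduct.map fun _ => blockOp k fun i => (u i).1 := rfl

/-- For all but finitely many `t` every block `N i + t` is invertible, so the tensor power of the
shifted operator comes from `GL_k`; `diag_mem_of_generic` then reaches `t = 0`. -/
theorem map_blockOp_mem_span {ℓ : ℕ} (k : Fin ℓ → ℕ) (d : ℕ)
    (N : ∀ i, Matrix (Fin (k i)) (Fin (k i)) ℂ) :
    (PiTensorProduct.map fun _ => blockOp k N : Module.End ℂ (TensorSpace k d)) ∈
      Submodule.span ℂ (Set.range (glAction k d)) := by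
  refine MultilinearMap.diag_mem_of_generic (K := ℂ) (E := Module.End ℂ (NatRep k))
    (F := Module.End ℂ (TensorSpace k d)) (tensorEnd k d) _ (blockOp k N) LinearMap.id
    -- The characteristic polynomial of `-N i` at `t` is `det (t + N i)`.
    (∏ i, (-N i).charpoly)
    (Finset.prod_ne_zero_iff.2 fun i _ => (Matrix.charpoly_monic _).ne_zero) fun t ht => ?_
  have hdet (i : Fin ℓ) : IsUnit (N i + t • 1) := by
    rw [Polynomial.eval_prod, Finset.prod_ne_zero_iff] at ht
    have h := ht i (Finset.mem_univ i)
    rw [Matrix.eval_charpoly, sub_neg_eq_add, add_comm, Matrix.scalar_apply,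
      ← Matrix.smul_one_eq_diagonal] at h
    exact (Matrix.isUnit_iff_isUnit_det _).2 h.isUnit
  refine Submodule.subset_span ⟨⟨diagGL k fun i => (hdet i).unit, _, rfl⟩, ?_⟩
  rw [glAction_apply, ← blockOp_add_smul_one]
  rfl

/-- Expanding the tensor power of the sum on the right chooses a summand `i` in each factor, and
such a choice is a coloring. -/
theorem sum_tensorProj_comp_map {ℓ : ℕ} (k : Fin ℓ → ℕ) (d : ℕ)
    (y : Module.End ℂ (NatRep k)) :
    ∑ f : Coloring ℓ d, tensorProj k f ∘ₗ PiTensorProduct.map (fun _ => y) ∘ₗ tensorProj k f =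
      PiTensorProduct.map fun _ => ∑ i, proj k i ∘ₗ y ∘ₗ proj k i := by
  have h := (tensorEnd k d).map_sum fun _ i => proj k i ∘ₗ y ∘ₗ proj k i
  refine Eq.trans ?_ h.symm
  refine Fintype.sum_equiv (Coloring.equivFun ℓ d) _ _ fun f => ?_
  rw [tensorProj, ← PiTensorProduct.map_comp, ← PiTensorProduct.map_comp]
  rfl

theorem sum_comp_tensorProj {ℓ d : ℕ} (k : Fin ℓ → ℕ) (Y : Module.End ℂ (TensorSpace k d)) :
    ∑ f : Coloring ℓ d, Y ∘ₗ tensorProj k f = Y := by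
  have h := Finset.mul_sum (R := Module.End ℂ (TensorSpace k d)) Finset.univ (tensorProj k) Y
  rw [sum_tensorProj] at h
  exact h.symm

/-- The projections onto the summands `G(f)` add up to the identity. Hence the image of `A_(ℓ,d)`
contains all permutations of the factors. -/
theorem groupoidAction_sum_morph {ℓ d : ℕ} (k : Fin ℓ → ℕ) (σ : Equiv.Perm (Fin d)) :
    groupoidAction k d (∑ f : Coloring ℓ d, CatAlg.morph (f.pushHom σ)) = permuteFactors k σ := by
  simp only [map_sum, groupoidAction_morph, morphAction]
  exact sum_comp_tensorProj k (permuteFactors k σ)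

/-- Commuting with `S_d` makes `Y` a combination of tensor powers of operators on `V`; commuting
with the projections makes it equal to its compression. Compressing the combination leaves only
tensor powers of block-diagonal operators. -/
theorem mem_span_glAction_of_mem_centralizer {ℓ d : ℕ} (k : Fin ℓ → ℕ)
    {Y : Module.End ℂ (TensorSpace k d)}
    (hY : Y ∈ Subalgebra.centralizer ℂ (Set.range (groupoidAction k d))) :
    Y ∈ Submodule.span ℂ (Set.range (glAction k d)) := by
  let compress : Module.End ℂ (TensorSpace k d) →ₗ[ℂ] Module.End ℂ (TensorSpace k d) :=
    ∑ f : Coloring ℓ d,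
      LinearMap.mulLeft ℂ (tensorProj k f : Module.End ℂ (TensorSpace k d)) ∘ₗ
        LinearMap.mulRight ℂ (tensorProj k f : Module.End ℂ (TensorSpace k d))
  have happ (Z : Module.End ℂ (TensorSpace k d)) :
      compress Z = ∑ f : Coloring ℓ d, tensorProj k f ∘ₗ Z ∘ₗ tensorProj k f := by
    simp only [compress, LinearMap.sum_apply]
    rfl
  have hcompress : compress Y = Y := by
    have h (f : Coloring ℓ d) :
        tensorProj k f ∘ₗ Y ∘ₗ tensorProj k f = Y ∘ₗ tensorProj k f := by
      have hf : tensorProj k f ∘ₗ Y = Y ∘ₗ tensorProj k f := by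
        rw [← morphAction_id, ← groupoidAction_morph]
        exact hY _ ⟨_, rfl⟩
      rw [← LinearMap.comp_assoc, hf, LinearMap.comp_assoc, tensorProj_comp, if_pos rfl]
    simp only [happ, h]
    exact sum_comp_tensorProj k Y
  have hspan := mem_span_map_const_of_commute k Y fun σ => by
    rw [← groupoidAction_sum_morph]
    exact hY _ ⟨_, rfl⟩
  rw [← hcompress]
  refine (Submodule.span_le (p := (Submodule.span ℂ (Set.range (glAction k d))).comap compress)).2
    ?_ hspan
  rintro _ ⟨y, rfl⟩
  rw [SetLike.mem_coe, Submodule.mem_comap, happ, sum_tensorProj_comp_map,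
    sum_proj_comp_proj_eq_blockOp]
  exact map_blockOp_mem_span k d _

/-! ### The two actions commute, and their centralizers -/

theorem commute_glAction_groupoidAction {ℓ d : ℕ} (k : Fin ℓ → ℕ) (x : BlockGL k)
    (a : GroupoidAlg ℓ d) :
    Commute (glAction k d x) (groupoidAction k d a) := by
  obtain ⟨_, u, rfl⟩ := x
  have hproj (f : Coloring ℓ d) :
      tensorProj k f ∘ₗ PiTensorProduct.map (fun _ => blockOp k fun i => (u i).1) =
        PiTensorProduct.map (fun _ => blockOp k fun i => (u i).1) ∘ₗ tensorProj k f := by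
    rw [tensorProj, ← PiTensorProduct.map_comp, ← PiTensorProduct.map_comp]
    simp only [proj_comp_blockOp]
  have hmorph {f g : Coloring ℓ d} (σ : f ⟶ g) :
      Commute (glAction k d ⟨diagGL k u, u, rfl⟩) (groupoidAction k d (CatAlg.morph σ)) := by
    rw [groupoidAction_morph, glAction_apply]
    change _ ∘ₗ (permuteFactors k σ.1 ∘ₗ tensorProj k f) =
      (permuteFactors k σ.1 ∘ₗ tensorProj k f) ∘ₗ _
    rw [LinearMap.comp_assoc, hproj, ← LinearMap.comp_assoc, ← LinearMap.comp_assoc,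
      permuteFactors_comp_map]
  have ha : a ∈ Submodule.span ℂ
      {a : GroupoidAlg ℓ d | ∃ (f g : Coloring ℓ d) (σ : f ⟶ g), a = CatAlg.morph σ} := by
    rw [CatAlg.span_morph]
    trivial
  induction ha using Submodule.span_induction with
  | mem a h =>
    obtain ⟨f, g, σ, rfl⟩ := h
    exact hmorph σ
  | zero =>
    rw [map_zero]
    exact Commute.zero_right _
  | add a b _ _ ha hb =>
    rw [map_add]
    exact ha.add_right hb
  | smul c a _ ha =>
    rw [map_smul]
    exact ha.smul_right c

theorem centralizer_range_groupoidAction {ℓ : ℕ} (k : Fin ℓ → ℕ) (d : ℕ) :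
    Subalgebra.centralizer ℂ (Set.range (groupoidAction k d)) =
      Algebra.adjoin ℂ (Set.range (glAction k d)) := by
  refine le_antisymm (fun Y hY => ?_) (Algebra.adjoin_le ?_)
  · exact Algebra.span_le_adjoin ℂ _ (mem_span_glAction_of_mem_centralizer k hY)
  · rintro _ ⟨x, rfl⟩ _ ⟨a, rfl⟩
    exact (commute_glAction_groupoidAction k x a).symm

/-- Commuting with `GL_k` means commuting with the algebra it generates, which is the centralizer of
the action of `A_(ℓ,d)`. The double centralizer theorem for the semisimple algebra `A_(ℓ,d)`
concludes. -/
theorem centralizer_range_glAction {ℓ : ℕ} [NeZero ℓ] (k : Fin ℓ → ℕ) (d : ℕ) :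
    Subalgebra.centralizer ℂ (Set.range (glAction k d)) =
      Algebra.adjoin ℂ (Set.range (groupoidAction k d)) := by
  refine le_antisymm ?_ (Algebra.adjoin_le ?_)
  · intro Y hY
    have h : Y ∈ Subalgebra.centralizer ℂ
        (Subalgebra.centralizer ℂ (Set.range (groupoidAction k d)) : Set _) := by
      rw [centralizer_range_groupoidAction]
      exact fun Z hZ => (Algebra.adjoin_le_centralizer_centralizer ℂ _ hZ Y hY).symm
    rw [Subalgebra.centralizer_centralizer_range_of_isSemisimpleRing] at h
    exact Algebra.subset_adjoin h
  · rintro _ ⟨a, rfl⟩ _ ⟨x, rfl⟩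
    exact commute_glAction_groupoidAction k x a

end SchurWeyl

end

theorem theorem3p12 (ℓ d : ℕ) (hℓ : 0 < ℓ) (k : Fin ℓ → ℕ) (hk : ∀ i, 0 < k i) :
    -- `A_(ℓ,d)` is isomorphic to the group algebra of `C_ℓ ≀ S_d`
    (∀ ξ : rootsOfUnity ℓ ℂ, IsPrimitiveRoot ξ ℓ →
      ∃ Φ : MonoidAlgebra ℂ (SchurWeyl.GenSym ℓ d) ≃ₐ[ℂ] SchurWeyl.GroupoidAlg ℓ d,
        (∀ σ : Equiv.Perm (Fin d),
          Φ (SchurWeyl.permElt ℓ σ) =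
            ∑ f : SchurWeyl.Coloring ℓ d, SchurWeyl.CatAlg.morph (f.pushHom σ)) ∧
        (∀ j : Fin d,
          Φ (SchurWeyl.diagElt ξ j) =
            ∑ f : SchurWeyl.Coloring ℓ d,
              (((ξ : ℂˣ) : ℂ) ^ ((f.color j : ℕ) + 1)) •
                SchurWeyl.CatAlg.morph (CategoryTheory.CategoryStruct.id f))) ∧
    -- the centralizer of the action of `GL_k` is generated by the action of `A_(ℓ,d)`
    Subalgebra.centralizer ℂ (Set.range (SchurWeyl.glAction k d)) =
      Algebra.adjoin ℂ (Set.range (SchurWeyl.groupoidAction k d)) ∧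
    -- the centralizer of the action of `A_(ℓ,d)` is generated by the action of `GL_k`
    Subalgebra.centralizer ℂ (Set.range (SchurWeyl.groupoidAction k d)) =
      Algebra.adjoin ℂ (Set.range (SchurWeyl.glAction k d)) := by
  have : NeZero ℓ := ⟨hℓ.ne'⟩
  -- The isomorphism is built from the characters of `C_ℓ ^ d` without choosing a root of unity, so
  -- a single map serves every `ξ`.
  refine ⟨fun ξ _ => ⟨SchurWeyl.wreathEquiv ℓ d, fun σ => ?_, fun j => ?_⟩,
    SchurWeyl.centralizer_range_glAction k d, SchurWeyl.centralizer_range_groupoidAction k d⟩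
  · exact (SchurWeyl.wreathEquiv_of _).trans (SchurWeyl.wreathHom_inr σ)
  · refine (SchurWeyl.wreathEquiv_of _).trans ?_
    simp only [SchurWeyl.wreathHom_inl, SchurWeyl.colorChar_mulSingle]
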